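/- Let $\mu$ be a finite (positive) Borel measure on $\mathbb{C}$ whose support is compact and infinite. Let $\Phi_n$ be the monic orthogonal polynomial of degree $n$ obtained from $1,z,z^2,\dots$ by Gram–Schmidt orthogonalization in $L^2(\mu)$, and let $\varphi_n=\kappa_n\Phi_n$, $\kappa_n=\|\Phi_n\|_{L^2(\mu)}^{-1}>0$, be the corresponding orthonormal polynomial. For $n\ge 1$ let $$\nu_n=\frac1n\sum_{k=1}^n\delta_{z_k},$$ where $z_1,\dots,z_n$ are the zeros of $\varphi_n$, each listed according to its multiplicity. Suppose that there are a real number $R>0$ and a function $f$ analytic in $\{z: R<|z|\le\infty\}$ such that $$\lim_{n\to\infty}\frac{\Phi_n(z)}{\Phi_{n+1}(z)}=f(z)\qquad\text{for every } z \text{ with } R<|z|\le\infty$$ (at $z=\infty$ the quotient takes its value as a rational function on the Riemann sphere). Then for every integer $j\ge 0$ both limits $$\lim_{n\to\infty}\int z^j\,d\nu_n(z)\qquad\text{and}\qquad\lim_{n\to\infty}\int z^j\,|\varphi_n(z)|^2\,d\mu(z)$$ exist, and they are equal. -/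

import Mathlib

open MeasureTheory Filter Topology Polynomial
open scoped ENNReal ComplexConjugate

noncomputable section

namespace OrthoPoly

/-- The `L²(μ)` inner product `∫ conj p · q dμ` of two polynomials, conjugate-linear in the
first argument. -/
def polyInner (μ : Measure ℂ) (p q : ℂ[X]) : ℂ :=
  ∫ z, conj (p.eval z) * q.eval z ∂μ

/-- The monic orthogonal polynomials `Φ_n` of `μ`: Gram-Schmidt orthogonalization, in `L²(μ)`,
of the sequence `1, z, z², …` (without normalization, so that `Φ_n` is monic of degree `n`). -/
def monicPoly (μ : Measure ℂ) (n : ℕ) : ℂ[X] :=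
  X ^ n - ∑ k : Fin n,
    C (polyInner μ (monicPoly μ k) (X ^ n) / polyInner μ (monicPoly μ k) (monicPoly μ k)) *
      monicPoly μ k
termination_by n
decreasing_by all_goals exact k.2

/-- The leading coefficient `κ_n = 1 / ‖Φ_n‖_{L²(μ)} > 0` of the orthonormal polynomial. -/
def leadCoeff (μ : Measure ℂ) (n : ℕ) : ℝ :=
  (√(∫ z, ‖(monicPoly μ n).eval z‖ ^ 2 ∂μ))⁻¹

/-- The orthonormal polynomials `φ_n = κ_n Φ_n` of `μ`. -/
def orthonormalPoly (μ : Measure ℂ) (n : ℕ) : ℂ[X] :=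
  C (leadCoeff μ n : ℂ) * monicPoly μ n

/-- The normalized zero-counting measure `ν_n = (1/n) ∑ δ_{z_j}`, the sum being over the zeros
of `φ_n`, each repeated according to its multiplicity. -/
def zeroCounting (μ : Measure ℂ) (n : ℕ) : Measure ℂ :=
  (n : ℝ≥0∞)⁻¹ • ((orthonormalPoly μ n).roots.map fun z => Measure.dirac z).sum

/-- The set `{z : R < |z| ≤ ∞}` in the Riemann sphere. -/
def exterior (R : ℝ) : Set (OnePoint ℂ) :=
  insert OnePoint.infty ((fun z : ℂ => (z : OnePoint ℂ)) '' {z : ℂ | R < ‖z‖})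

/-- The coordinate `w ↦ 1/w` of the Riemann sphere centred at `∞`. -/
def chartAtInfty (w : ℂ) : OnePoint ℂ :=
  if w = 0 then OnePoint.infty else ((w⁻¹ : ℂ) : OnePoint ℂ)

/-- `f` is analytic in `{z : R < |z| ≤ ∞}`: it is analytic at each finite point, and
`w ↦ f (1/w)` is analytic at `w = 0`. -/
structure AnalyticOnExterior (f : OnePoint ℂ → ℂ) (R : ℝ) : Prop where
  finite : AnalyticOnNhd ℂ (fun z : ℂ => f (z : OnePoint ℂ)) {z : ℂ | R < ‖z‖}
  infty : AnalyticAt ℂ (fun w : ℂ => f (chartAtInfty w)) 0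

/-- The value of the rational function `p / q` at a point of the Riemann sphere; at `∞` it is
the limit of `p z / q z` as `|z| → ∞`. -/
def ratioAt (p q : ℂ[X]) : OnePoint ℂ → ℂ
  | OnePoint.infty => limUnder (cocompact ℂ) fun z => p.eval z / q.eval z
  | OnePoint.some z => p.eval z / q.eval z

end OrthoPoly

end

/-! Let H be the matrix of multiplication by z in the basis of the monic Φ_k: upper Hessenberg, with
subdiagonal 1. The diagonal entry (H^j)_{nn} is ∫ z^j |φ_n|² dμ, because rescaling Φ_n to φ_n does
not change diagonal entries. The n × n truncation H_n has characteristic polynomial Φ_n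
(`charpoly_truncHess`), so ∫ z^j dν_n = tr(H_n^j)/n.

The diagonal entries of H_n^j and H^j agree except in the last j places (`truncHess_pow_apply`).
There both are bounded independently of n, so tr(H_n^j)/n differs by O(1/n) from the Cesàro mean of
the (H^j)_{kk}. If (H^j)_{nn} converges, both limits therefore exist and coincide
(`tendsto_trace_truncHess_pow`).

It remains to see that (H^j)_{nn} converges. It is a sum of boundedly many products of entries of H
near the diagonal, so it suffices that each diagonal of H converges (`exists_tendsto_pow_diagonal`).
This is where ratio asymptotics enter (`exists_tendsto_diagonal`): dividing the recurrence for zΦ_n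
by Φ_n expresses Φ_{n+1}/Φ_n through the entries H_{n,n}, H_{n-1,n}, …, weighted by products of
ratios Φ_{k}/Φ_{k+1} = O(1/|z|). Letting z grow isolates these diagonals one at a time. -/

namespace OrthoPoly

/-! ### The L²(μ) semi-inner product on polynomials. -/

section InnerProduct

variable {μ : Measure ℂ}

theorem integrable_of_continuous [IsFiniteMeasure μ] (hc : IsCompact μ.support) {g : ℂ → ℂ} (hg : Continuous g) :
    Integrable g μ := by
  have h : μ.restrict μ.support = μ := Measure.restrict_eq_self_of_ae_mem Measure.support_mem_ae
  have := hg.continuousOn.integrableOn_compact (μ := μ) hc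
  rwa [IntegrableOn, h] at this

theorem integrable_of_continuous_real [IsFiniteMeasure μ] (hc : IsCompact μ.support) {g : ℂ → ℝ} (hg : Continuous g) :
    Integrable g μ := by
  have h : μ.restrict μ.support = μ := Measure.restrict_eq_self_of_ae_mem Measure.support_mem_ae
  have := hg.continuousOn.integrableOn_compact (μ := μ) hc
  rwa [IntegrableOn, h] at this

theorem integrable_polyInner [IsFiniteMeasure μ] (hc : IsCompact μ.support) (p q : ℂ[X]) :
    Integrable (fun z => conj (p.eval z) * q.eval z) μ :=
  integrable_of_continuous hc (by fun_prop)

theorem polyInner_conj (p q : ℂ[X]) : conj (polyInner μ q p) = polyInner μ p q := by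
  simp only [polyInner, ← integral_conj]
  congr 1 with z
  simp [mul_comm]

theorem polyInner_add_left [IsFiniteMeasure μ] (hc : IsCompact μ.support) (p q r : ℂ[X]) :
    polyInner μ (p + q) r = polyInner μ p r + polyInner μ q r := by
  simp only [polyInner]
  rw [← integral_add (integrable_polyInner hc p r) (integrable_polyInner hc q r)]
  congr 1 with z
  simp [add_mul]

theorem polyInner_add_right [IsFiniteMeasure μ] (hc : IsCompact μ.support) (p q r : ℂ[X]) :
    polyInner μ p (q + r) = polyInner μ p q + polyInner μ p r := by
  simp only [polyInner]
  rw [← integral_add (integrable_polyInner hc p q) (integrable_polyInner hc p r)]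
  congr 1 with z
  simp [mul_add]

theorem polyInner_C_mul_right (c : ℂ) (p q : ℂ[X]) :
    polyInner μ p (C c * q) = c * polyInner μ p q := by
  simp only [polyInner, ← integral_const_mul]
  congr 1 with z
  simp only [eval_mul, eval_C]
  ring

theorem polyInner_C_mul_left (c : ℂ) (p q : ℂ[X]) :
    polyInner μ (C c * p) q = conj c * polyInner μ p q := by
  simp only [polyInner, ← integral_const_mul]
  congr 1 with z
  simp only [eval_mul, eval_C, map_mul]
  ring

theorem polyInner_sub_right [IsFiniteMeasure μ] (hc : IsCompact μ.support) (p q r : ℂ[X]) :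
    polyInner μ p (q - r) = polyInner μ p q - polyInner μ p r := by
  rw [eq_sub_iff_add_eq, ← polyInner_add_right hc, sub_add_cancel]

theorem polyInner_zero_right (p : ℂ[X]) : polyInner μ p 0 = 0 := by
  simp [polyInner]

theorem polyInner_sum_right [IsFiniteMeasure μ] (hc : IsCompact μ.support) {ι : Type*} (s : Finset ι) (p : ℂ[X])
    (q : ι → ℂ[X]) : polyInner μ p (∑ i ∈ s, q i) = ∑ i ∈ s, polyInner μ p (q i) := by
  classical
  induction s using Finset.induction_on with
  | empty => simp [polyInner_zero_right]
  | insert a s ha ih => rw [Finset.sum_insert ha, Finset.sum_insert ha, polyInner_add_right hc, ih]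

/-- The `L²(μ)` seminorm of a polynomial. -/
noncomputable def polyNorm (μ : Measure ℂ) (p : ℂ[X]) : ℝ := √(∫ z, ‖p.eval z‖ ^ 2 ∂μ)

theorem polyInner_self (p : ℂ[X]) : polyInner μ p p = ((polyNorm μ p ^ 2 : ℝ) : ℂ) := by
  rw [polyNorm, Real.sq_sqrt (integral_nonneg fun z => by positivity), polyInner]
  rw [← integral_complex_ofReal]
  congr 1 with z
  rw [← Complex.normSq_eq_conj_mul_self, Complex.normSq_eq_norm_sq]

theorem polyNorm_nonneg (p : ℂ[X]) : 0 ≤ polyNorm μ p := Real.sqrt_nonneg _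

/-- The `L²(μ)` semi-inner product on polynomials. -/
@[reducible]
noncomputable def polyCore [IsFiniteMeasure μ] (hc : IsCompact μ.support) : PreInnerProductSpace.Core ℂ ℂ[X] where
  inner := polyInner μ
  conj_inner_symm := polyInner_conj
  re_inner_nonneg p := by
    rw [polyInner_self]
    exact_mod_cast sq_nonneg (polyNorm μ p)
  add_left := polyInner_add_left hc
  smul_left p q c := by rw [smul_eq_C_mul, polyInner_C_mul_left]

theorem norm_polyInner_le [IsFiniteMeasure μ] (hc : IsCompact μ.support) (p q : ℂ[X]) :
    ‖polyInner μ p q‖ ≤ polyNorm μ p * polyNorm μ q := by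
  have key (r : ℂ[X]) : √(Complex.re (polyInner μ r r)) = polyNorm μ r := by
    rw [polyInner_self, Complex.ofReal_re, Real.sqrt_sq (polyNorm_nonneg r)]
  have := @InnerProductSpace.Core.norm_inner_le_norm ℂ ℂ[X] _ _ _ (polyCore hc) p q
  rw [← key p, ← key q]
  exact this

theorem polyNorm_X_mul_le [IsFiniteMeasure μ] (hc : IsCompact μ.support) {ρ : ℝ} (hρ : 0 ≤ ρ)
    (hs : μ.support ⊆ Metric.closedBall 0 ρ) (p : ℂ[X]) :
    polyNorm μ (X * p) ≤ ρ * polyNorm μ p := by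
  rw [polyNorm, polyNorm, ← Real.sqrt_sq hρ, ← Real.sqrt_mul (by positivity), ← integral_const_mul]
  refine Real.sqrt_le_sqrt (integral_mono_ae ?_ ?_ ?_)
  · exact integrable_of_continuous_real hc (by fun_prop)
  · exact integrable_of_continuous_real hc (by fun_prop)
  · filter_upwards [Measure.support_mem_ae (μ := μ)] with z hz
    have : ‖z‖ ≤ ρ := by simpa using hs hz
    simp only [eval_mul, eval_X, norm_mul, mul_pow]
    gcongr

/-- A polynomial of norm zero vanishes μ-a.e.; its zero set is closed, hence contains the infinite
support. -/
theorem polyNorm_pos [IsFiniteMeasure μ] (hc : IsCompact μ.support)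
    (hinf : μ.support.Infinite) {p : ℂ[X]} (hp : p ≠ 0) : 0 < polyNorm μ p := by
  refine Real.sqrt_pos.2 (lt_of_le_of_ne (integral_nonneg fun z => by positivity) fun h => ?_)
  have h0 := (integral_eq_zero_iff_of_nonneg (fun z => by positivity)
    (integrable_of_continuous_real hc (g := fun z => ‖p.eval z‖ ^ 2) (by fun_prop))).1 h.symm
  have hsub : μ.support ⊆ {z | p.eval z = 0} := by
    refine Measure.support_subset_of_isClosed
      (isClosed_eq (by fun_prop) continuous_const) ?_
    filter_upwards [h0] with z hz
    simpa using hz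
  refine hinf ((p.roots.toFinset.finite_toSet).subset fun z hz => ?_)
  have := hsub hz
  simpa [hp] using this

end InnerProduct

/-! ### Orthogonality and the Hessenberg matrix of multiplication by z. -/

section MonicPoly

variable {μ : Measure ℂ}

theorem exists_monicPoly_eq (μ : Measure ℂ) (n : ℕ) :
    ∃ q : ℂ[X], q.degree < n ∧ monicPoly μ n = X ^ n + q ∧
      (monicPoly μ n).Monic ∧ (monicPoly μ n).natDegree = n := by
  induction n using Nat.strong_induction_on with
  | _ n ih =>
    set q : ℂ[X] := -∑ k : Fin n,
      C (polyInner μ (monicPoly μ k) (X ^ n) / polyInner μ (monicPoly μ k) (monicPoly μ k)) *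
        monicPoly μ k with hq
    have hdeg : q.degree < n := by
      rw [hq, degree_neg, ← mem_degreeLT]
      refine Submodule.sum_mem _ fun k _ => ?_
      rw [← smul_eq_C_mul]
      refine Submodule.smul_mem _ _ (mem_degreeLT.2 ?_)
      obtain ⟨_, _, _, hm, hd⟩ := ih k k.2
      rw [degree_eq_natDegree hm.ne_zero, hd]
      exact_mod_cast k.2
    have heq : monicPoly μ n = X ^ n + q := by
      rw [monicPoly, sub_eq_add_neg]
    refine ⟨q, hdeg, heq, heq ▸ monic_X_pow_add hdeg, ?_⟩
    rw [heq]
    refine natDegree_eq_of_degree_eq_some ?_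
    rw [degree_add_eq_left_of_degree_lt (by rwa [degree_X_pow]), degree_X_pow]

theorem monicPoly_monic (μ : Measure ℂ) (n : ℕ) : (monicPoly μ n).Monic :=
  (exists_monicPoly_eq μ n).choose_spec.2.2.1

theorem monicPoly_natDegree (μ : Measure ℂ) (n : ℕ) : (monicPoly μ n).natDegree = n :=
  (exists_monicPoly_eq μ n).choose_spec.2.2.2

theorem monicPoly_zero (μ : Measure ℂ) : monicPoly μ 0 = 1 := by
  rw [monicPoly]
  simp

theorem monicPoly_degree (μ : Measure ℂ) (n : ℕ) : (monicPoly μ n).degree = n := by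
  rw [degree_eq_natDegree (monicPoly_monic μ n).ne_zero, monicPoly_natDegree]

theorem polyNorm_monicPoly_pos [IsFiniteMeasure μ] (hc : IsCompact μ.support)
    (hinf : μ.support.Infinite) (n : ℕ) : 0 < polyNorm μ (monicPoly μ n) :=
  polyNorm_pos hc hinf (monicPoly_monic μ n).ne_zero

theorem polyInner_monicPoly_self_ne_zero [IsFiniteMeasure μ] (hc : IsCompact μ.support)
    (hinf : μ.support.Infinite) (n : ℕ) :
    polyInner μ (monicPoly μ n) (monicPoly μ n) ≠ 0 := by
  rw [polyInner_self]
  exact_mod_cast (pow_pos (polyNorm_monicPoly_pos hc hinf n) 2).ne'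

theorem polyInner_monicPoly_of_lt [IsFiniteMeasure μ] (hc : IsCompact μ.support)
    (hinf : μ.support.Infinite) (n : ℕ) :
    ∀ k < n, polyInner μ (monicPoly μ k) (monicPoly μ n) = 0 := by
  induction n using Nat.strong_induction_on with
  | _ n ih =>
    intro k hk
    rw [monicPoly.eq_1 μ n, polyInner_sub_right hc, polyInner_sum_right hc,
      Finset.sum_eq_single (⟨k, hk⟩ : Fin n)]
    · rw [polyInner_C_mul_right, div_mul_cancel₀ _ (polyInner_monicPoly_self_ne_zero hc hinf k),
        sub_self]
    · intro i _ hik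
      have hik' : (i : ℕ) ≠ k := fun h => hik (Fin.ext h)
      rw [polyInner_C_mul_right]
      rcases lt_or_gt_of_ne hik' with h | h
      · rw [← polyInner_conj (monicPoly μ k), ih k hk i h, map_zero, mul_zero]
      · rw [ih i i.2 k h, mul_zero]
    · simp

theorem polyInner_monicPoly_of_ne [IsFiniteMeasure μ] (hc : IsCompact μ.support)
    (hinf : μ.support.Infinite) {k n : ℕ} (h : k ≠ n) :
    polyInner μ (monicPoly μ k) (monicPoly μ n) = 0 := by
  rcases lt_or_gt_of_ne h with h | h
  · exact polyInner_monicPoly_of_lt hc hinf n k h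
  · rw [← polyInner_conj, polyInner_monicPoly_of_lt hc hinf k n h, map_zero]

/-- The `k`-th coefficient of `p` in the basis of the monic orthogonal polynomials. -/
noncomputable def fourierCoeff (μ : Measure ℂ) (k : ℕ) (p : ℂ[X]) : ℂ :=
  polyInner μ (monicPoly μ k) p / polyInner μ (monicPoly μ k) (monicPoly μ k)

theorem exists_eq_sum_monicPoly (μ : Measure ℂ) (m : ℕ) (p : ℂ[X]) (hp : p.degree < m) :
    ∃ c : ℕ → ℂ, p = ∑ k ∈ Finset.range m, C (c k) * monicPoly μ k := by
  induction m generalizing p with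
  | zero =>
    refine ⟨0, ?_⟩
    simpa [Nat.WithBot.lt_zero_iff] using hp
  | succ m ih =>
    obtain ⟨c, hcp⟩ := ih (p - C (p.coeff m) * monicPoly μ m) <| by
      rw [degree_lt_iff_coeff_zero] at hp ⊢
      intro i hi
      rw [coeff_sub, coeff_C_mul]
      rcases hi.eq_or_lt with rfl | hlt
      · have := (monicPoly_monic μ m).coeff_natDegree
        rw [monicPoly_natDegree] at this
        rw [this, mul_one, sub_self]
      · rw [hp i hlt, coeff_eq_zero_of_natDegree_lt (p := monicPoly μ m)
          (by rwa [monicPoly_natDegree]), mul_zero, sub_zero]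
    refine ⟨fun k => if k = m then p.coeff m else c k, ?_⟩
    beta_reduce
    rw [Finset.sum_range_succ, if_pos rfl, ← sub_eq_iff_eq_add, hcp]
    refine Finset.sum_congr rfl fun k hk => ?_
    rw [if_neg (Finset.mem_range.1 hk).ne]

theorem fourierCoeff_sum_monicPoly [IsFiniteMeasure μ] (hc : IsCompact μ.support)
    (hinf : μ.support.Infinite) (s : Finset ℕ) (c : ℕ → ℂ) (k : ℕ) :
    fourierCoeff μ k (∑ i ∈ s, C (c i) * monicPoly μ i) = if k ∈ s then c k else 0 := by
  rw [fourierCoeff, polyInner_sum_right hc]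
  simp_rw [polyInner_C_mul_right]
  split_ifs with hk
  · rw [Finset.sum_eq_single k, mul_div_cancel_right₀ _
      (polyInner_monicPoly_self_ne_zero hc hinf k)]
    · intro i _ hik
      rw [polyInner_monicPoly_of_ne hc hinf hik.symm, mul_zero]
    · exact fun h => absurd hk h
  · rw [Finset.sum_eq_zero, zero_div]
    intro i hi
    rw [polyInner_monicPoly_of_ne hc hinf (by rintro rfl; exact hk hi), mul_zero]

theorem eq_sum_fourierCoeff [IsFiniteMeasure μ] (hc : IsCompact μ.support)
    (hinf : μ.support.Infinite) {m : ℕ} {p : ℂ[X]} (hp : p.degree < m) :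
    p = ∑ k ∈ Finset.range m, C (fourierCoeff μ k p) * monicPoly μ k := by
  obtain ⟨c, hcp⟩ := exists_eq_sum_monicPoly μ m p hp
  conv_lhs => rw [hcp]
  refine Finset.sum_congr rfl fun k hk => ?_
  rw [hcp, fourierCoeff_sum_monicPoly hc hinf, if_pos hk]

theorem fourierCoeff_eq_zero_of_degree_lt [IsFiniteMeasure μ] (hc : IsCompact μ.support)
    (hinf : μ.support.Infinite) {k : ℕ} {p : ℂ[X]} (hp : p.degree < k) :
    fourierCoeff μ k p = 0 := by
  obtain ⟨c, hcp⟩ := exists_eq_sum_monicPoly μ k p hp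
  rw [hcp, fourierCoeff_sum_monicPoly hc hinf, if_neg (by simp)]

theorem fourierCoeff_monicPoly [IsFiniteMeasure μ] (hc : IsCompact μ.support)
    (hinf : μ.support.Infinite) (k l : ℕ) :
    fourierCoeff μ k (monicPoly μ l) = if k = l then 1 else 0 := by
  have := fourierCoeff_sum_monicPoly hc hinf {l} (fun _ => 1) k
  simpa using this

theorem fourierCoeff_sub [IsFiniteMeasure μ] (hc : IsCompact μ.support) (k : ℕ) (p q : ℂ[X]) :
    fourierCoeff μ k (p - q) = fourierCoeff μ k p - fourierCoeff μ k q := by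
  rw [fourierCoeff, polyInner_sub_right hc, sub_div, fourierCoeff, fourierCoeff]

theorem degree_X_mul_monicPoly_sub_lt (μ : Measure ℂ) (l : ℕ) :
    (X * monicPoly μ l - monicPoly μ (l + 1)).degree < ((l + 1 : ℕ) : WithBot ℕ) := by
  have hX : (X * monicPoly μ l).Monic := monic_X.mul (monicPoly_monic μ l)
  have hd : (X * monicPoly μ l).degree = ((l + 1 : ℕ) : WithBot ℕ) := by
    rw [degree_mul, degree_X, monicPoly_degree, Nat.cast_add, Nat.cast_one, add_comm]
  have := degree_sub_lt_left (p := X * monicPoly μ l) (q := monicPoly μ (l + 1))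
    (by rw [hd, monicPoly_degree]) hX.ne_zero
    (by rw [hX.leadingCoeff, (monicPoly_monic μ (l + 1)).leadingCoeff])
  rwa [hd] at this

/-- The entries of the matrix of multiplication by `X` in the basis of the monic orthogonal
polynomials. -/
noncomputable def hess (μ : Measure ℂ) (k l : ℕ) : ℂ := fourierCoeff μ k (X * monicPoly μ l)

theorem hess_succ [IsFiniteMeasure μ] (hc : IsCompact μ.support)
    (hinf : μ.support.Infinite) (l : ℕ) : hess μ (l + 1) l = 1 := by
  have := fourierCoeff_eq_zero_of_degree_lt hc hinf (degree_X_mul_monicPoly_sub_lt μ l)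
  rw [fourierCoeff_sub hc, fourierCoeff_monicPoly hc hinf, if_pos rfl, sub_eq_zero] at this
  exact this

theorem fourierCoeff_X_pow_mul_eq_zero [IsFiniteMeasure μ] (hc : IsCompact μ.support)
    (hinf : μ.support.Infinite) {j k l : ℕ} (h : l + j < k) :
    fourierCoeff μ k (X ^ j * monicPoly μ l) = 0 := by
  refine fourierCoeff_eq_zero_of_degree_lt hc hinf ?_
  rw [degree_mul, degree_X_pow, monicPoly_degree]
  exact_mod_cast (by lia : j + l < k)

theorem hess_eq_zero [IsFiniteMeasure μ] (hc : IsCompact μ.support)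
    (hinf : μ.support.Infinite) {k l : ℕ} (h : l + 1 < k) : hess μ k l = 0 := by
  rw [hess, ← pow_one X]
  exact fourierCoeff_X_pow_mul_eq_zero hc hinf h

theorem X_mul_monicPoly [IsFiniteMeasure μ] (hc : IsCompact μ.support)
    (hinf : μ.support.Infinite) (l : ℕ) :
    X * monicPoly μ l = ∑ k ∈ Finset.range (l + 2), C (hess μ k l) * monicPoly μ k := by
  refine eq_sum_fourierCoeff hc hinf ?_
  rw [degree_mul, degree_X, monicPoly_degree]
  exact_mod_cast (by lia : 1 + l < l + 2)

theorem fourierCoeff_X_pow_succ [IsFiniteMeasure μ] (hc : IsCompact μ.support)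
    (hinf : μ.support.Infinite) (j k l : ℕ) :
    fourierCoeff μ k (X ^ (j + 1) * monicPoly μ l) =
      ∑ m ∈ Finset.range (l + 2), fourierCoeff μ k (X ^ j * monicPoly μ m) * hess μ m l := by
  rw [pow_succ, mul_assoc, X_mul_monicPoly hc hinf, Finset.mul_sum, fourierCoeff,
    polyInner_sum_right hc, Finset.sum_div]
  refine Finset.sum_congr rfl fun m _ => ?_
  rw [mul_left_comm, polyInner_C_mul_right, fourierCoeff]
  ring

/-- Since the subdiagonal entry is 1, ⟨Φ_{l+1}, zΦ_l⟩ = ‖Φ_{l+1}‖²; apply Cauchy–Schwarz and cancel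
one factor. -/
theorem polyNorm_monicPoly_succ_le [IsFiniteMeasure μ] (hc : IsCompact μ.support)
    (hinf : μ.support.Infinite) {ρ : ℝ} (hρ : 0 ≤ ρ) (hs : μ.support ⊆ Metric.closedBall 0 ρ)
    (l : ℕ) : polyNorm μ (monicPoly μ (l + 1)) ≤ ρ * polyNorm μ (monicPoly μ l) := by
  have hpos := polyNorm_monicPoly_pos hc hinf (l + 1)
  have h1 := hess_succ hc hinf l
  rw [hess, fourierCoeff, div_eq_one_iff_eq (polyInner_monicPoly_self_ne_zero hc hinf _),
    polyInner_self] at h1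
  have h2 := norm_polyInner_le hc (monicPoly μ (l + 1)) (X * monicPoly μ l)
  rw [h1, Complex.norm_real, Real.norm_of_nonneg (by positivity), sq] at h2
  exact (le_of_mul_le_mul_left h2 hpos).trans (polyNorm_X_mul_le hc hρ hs _)

theorem polyNorm_monicPoly_add_le [IsFiniteMeasure μ] (hc : IsCompact μ.support)
    (hinf : μ.support.Infinite) {ρ : ℝ} (hρ : 0 ≤ ρ) (hs : μ.support ⊆ Metric.closedBall 0 ρ)
    (k i : ℕ) : polyNorm μ (monicPoly μ (k + i)) ≤ ρ ^ i * polyNorm μ (monicPoly μ k) := by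
  induction i with
  | zero => simp
  | succ i ih =>
    calc _ ≤ ρ * polyNorm μ (monicPoly μ (k + i)) :=
          polyNorm_monicPoly_succ_le hc hinf hρ hs (k + i)
      _ ≤ ρ * (ρ ^ i * polyNorm μ (monicPoly μ k)) := by gcongr
      _ = _ := by ring

/-- In this unnormalized basis the bound depends only on the distance to the diagonal, because the
norm ratio ‖Φ_{k+i}‖/‖Φ_k‖ is at most ρ^i. -/
theorem norm_hess_le [IsFiniteMeasure μ] (hc : IsCompact μ.support)
    (hinf : μ.support.Infinite) {ρ : ℝ} (hρ : 0 ≤ ρ) (hs : μ.support ⊆ Metric.closedBall 0 ρ)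
    (k i : ℕ) : ‖hess μ k (k + i)‖ ≤ ρ ^ (i + 1) := by
  have hpos := polyNorm_monicPoly_pos hc hinf k
  rw [hess, fourierCoeff, norm_div, polyInner_self, Complex.norm_real,
    Real.norm_of_nonneg (by positivity), div_le_iff₀ (by positivity)]
  calc _ ≤ _ := norm_polyInner_le hc _ _
    _ ≤ polyNorm μ (monicPoly μ k) * (ρ * (ρ ^ i * polyNorm μ (monicPoly μ k))) := by
      gcongr
      refine (polyNorm_X_mul_le hc hρ hs _).trans ?_
      gcongr
      exact polyNorm_monicPoly_add_le hc hinf hρ hs k i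
    _ = _ := by ring

theorem integral_mul_norm_orthonormalPoly_sq [IsFiniteMeasure μ] (hc : IsCompact μ.support)
    (hinf : μ.support.Infinite) (j n : ℕ) :
    ∫ z, z ^ j * ((‖(orthonormalPoly μ n).eval z‖ ^ 2 : ℝ) : ℂ) ∂μ =
      fourierCoeff μ n (X ^ j * monicPoly μ n) := by
  have hpos := polyNorm_monicPoly_pos hc hinf n
  have hlead : leadCoeff μ n = (polyNorm μ (monicPoly μ n))⁻¹ := rfl
  rw [fourierCoeff, polyInner_self, div_eq_inv_mul, polyInner, ← integral_const_mul]
  congr 1 with z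
  rw [orthonormalPoly, hlead, eval_mul, eval_C, norm_mul, mul_pow, Complex.norm_real,
    Real.norm_of_nonneg (by positivity), inv_pow, eval_mul, eval_pow, eval_X, Complex.ofReal_mul,
    Complex.ofReal_inv, ← Complex.normSq_eq_norm_sq (eval z _), Complex.normSq_eq_conj_mul_self]
  ring

end MonicPoly

/-! ### From ratio asymptotics to convergence along diagonals. -/

section Recurrence

variable {T : ℕ → ℕ → ℂ} {ρ : ℝ}

theorem norm_le_norm_succ_of_recurrence {z : ℂ} {v : ℕ → ℂ} {n : ℕ} (hz : 4 * ρ ≤ ‖z‖)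
    (hrec : z * v n = v (n + 1) + ∑ m ∈ Finset.range (n + 1), T m n * v m)
    (hB : ‖∑ m ∈ Finset.range (n + 1), T m n * v m‖ ≤ 2 * ρ * ‖v n‖) :
    ‖z‖ * ‖v n‖ ≤ 2 * ‖v (n + 1)‖ := by
  have h1 : ‖z‖ * ‖v n‖ ≤ ‖v (n + 1)‖ + 2 * ρ * ‖v n‖ := by
    rw [← norm_mul, hrec]
    exact (norm_add_le _ _).trans (by gcongr)
  have h2 : 4 * ρ * ‖v n‖ ≤ ‖z‖ * ‖v n‖ := by gcongr
  linarith

/-- Induction on n with all shifts q at once: the bound at (n+1, q) uses the one at (n, q+1). The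
case q = 0 gives the growth |v_{n+1}| ≥ (|z|/2)|v_n| ≥ 2ρ|v_n|, which absorbs the extra factor ρ and
keeps the constant 2. -/
theorem ne_zero_and_norm_sum_le_of_recurrence (hρ : 0 < ρ)
    (hT : ∀ k i, ‖T k (k + i)‖ ≤ ρ ^ (i + 1)) {z : ℂ} {v : ℕ → ℂ} (hz : 4 * ρ ≤ ‖z‖)
    (h0 : v 0 = 1)
    (hrec : ∀ n, z * v n = v (n + 1) + ∑ m ∈ Finset.range (n + 1), T m n * v m) (n : ℕ) :
    v n ≠ 0 ∧ ∀ q, ‖∑ m ∈ Finset.range (n + 1), T m (n + q) * v m‖ ≤ 2 * ρ ^ (q + 1) * ‖v n‖ := by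
  induction n with
  | zero =>
    refine ⟨by simp [h0], fun q => ?_⟩
    have := hT 0 q
    simp only [zero_add, Finset.range_one, Finset.sum_singleton, h0, mul_one, norm_one] at this ⊢
    linarith [pow_pos hρ (q + 1)]
  | succ n ih =>
    obtain ⟨hn, hB⟩ := ih
    have hgrow := norm_le_norm_succ_of_recurrence hz (hrec n) (by simpa using hB 0)
    have h2 : 4 * ρ * ‖v n‖ ≤ ‖z‖ * ‖v n‖ := by gcongr
    have hpos : 0 < 4 * ρ * ‖v n‖ := by positivity
    refine ⟨norm_pos_iff.1 (by linarith), fun q => ?_⟩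
    rw [Finset.sum_range_succ, add_assoc n 1 q, add_comm 1 q]
    calc _ ≤ 2 * ρ ^ (q + 1 + 1) * ‖v n‖ + ρ ^ (q + 1) * ‖v (n + 1)‖ := by
          refine (norm_add_le _ _).trans (add_le_add (hB (q + 1)) ?_)
          rw [norm_mul]
          have := hT (n + 1) q
          rw [add_assoc n 1 q, add_comm 1 q] at this
          gcongr
      _ = ρ ^ (q + 1) * (2 * ρ * ‖v n‖) + ρ ^ (q + 1) * ‖v (n + 1)‖ := by ring
      _ ≤ ρ ^ (q + 1) * ‖v (n + 1)‖ + ρ ^ (q + 1) * ‖v (n + 1)‖ := by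
          gcongr
          linarith
      _ = _ := by ring

/-- A uniform limit of convergent sequences is Cauchy. This is the exchange of the limits in n and
z. -/
theorem exists_tendsto_of_approx {t : ℕ → ℂ}
    (h : ∀ ε > 0, ∃ w : ℕ → ℂ, (∃ L, Tendsto w atTop (𝓝 L)) ∧ ∀ n, ‖t n - w n‖ ≤ ε) :
    ∃ L, Tendsto t atTop (𝓝 L) := by
  refine cauchySeq_tendsto_of_complete (Metric.cauchySeq_iff'.2 fun ε hε => ?_)
  obtain ⟨w, ⟨L, hL⟩, hw⟩ := h (ε / 4) (by positivity)
  obtain ⟨N, hN⟩ := Metric.cauchySeq_iff'.1 hL.cauchySeq (ε / 4) (by positivity)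
  refine ⟨N, fun n hn => ?_⟩
  have h1 := hN n hn
  have h2 := hw n
  have h3 := hw N
  rw [dist_eq_norm] at h1 ⊢
  have : t n - t N = (t n - w n) + (w n - w N) - (t N - w N) := by ring
  rw [this]
  have := norm_sub_le ((t n - w n) + (w n - w N)) (t N - w N)
  have := norm_add_le (t n - w n) (w n - w N)
  linarith

theorem exists_tendsto_comp_add {t : ℕ → ℂ} (m : ℕ)
    (h : ∃ L, Tendsto (fun n => t (n + m)) atTop (𝓝 L)) : ∃ L, Tendsto t atTop (𝓝 L) :=
  h.imp fun _ hL => (tendsto_add_atTop_iff_nat m).1 hL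

/-- If the solutions of an infinite Hessenberg recurrence have ratio asymptotics near `∞`, then
the coefficients of the recurrence converge along diagonals. -/
theorem exists_tendsto_diagonal (hρ : 0 < ρ) (hT : ∀ k i, ‖T k (k + i)‖ ≤ ρ ^ (i + 1)) {R : ℝ}
    {u : ℂ → ℕ → ℂ} (h0 : ∀ z, u z 0 = 1)
    (hrec : ∀ z n, z * u z n = u z (n + 1) + ∑ m ∈ Finset.range (n + 1), T m n * u z m)
    (hratio : ∀ z : ℂ, R < ‖z‖ → ∃ L, Tendsto (fun n => u z n / u z (n + 1)) atTop (𝓝 L)) (q : ℕ) :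
    ∃ L, Tendsto (fun n => T n (n + q)) atTop (𝓝 L) := by
  -- The summand m = n of U q z n is T n (n+q) itself; the remaining summands are O(1/|z|) uniformly
  -- in n, by `hstep`, `hlow` and `hmain` below.
  set U : ℕ → ℂ → ℕ → ℂ := fun q z n =>
    (∑ m ∈ Finset.range (n + 1), T m (n + q) * u z m) / u z n with hU
  have hmain : ∀ z : ℂ, 4 * ρ ≤ ‖z‖ → ∀ n, u z n ≠ 0 ∧ ∀ q, ‖U q z n‖ ≤ 2 * ρ ^ (q + 1) := by
    intro z hz n
    obtain ⟨h1, h2⟩ := ne_zero_and_norm_sum_le_of_recurrence hρ hT hz (h0 z) (hrec z) n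
    refine ⟨h1, fun q => ?_⟩
    rw [hU, norm_div, div_le_iff₀ (norm_pos_iff.2 h1)]
    exact h2 q
  have hlow : ∀ z : ℂ, 4 * ρ ≤ ‖z‖ → ∀ n, ‖u z n / u z (n + 1)‖ ≤ 2 / ‖z‖ := by
    intro z hz n
    have hzpos : 0 < ‖z‖ := by linarith
    have h2 := (ne_zero_and_norm_sum_le_of_recurrence hρ hT hz (h0 z) (hrec z) n).2 0
    have := norm_le_norm_succ_of_recurrence hz (hrec z n) (by simpa using h2)
    rw [norm_div, div_le_div_iff₀ (norm_pos_iff.2 (hmain z hz (n + 1)).1) hzpos]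
    linarith
  have hstep : ∀ z : ℂ, 4 * ρ ≤ ‖z‖ → ∀ q n,
      U q z (n + 1) = T (n + 1) (n + 1 + q) + u z n / u z (n + 1) * U (q + 1) z n := by
    intro z hz q n
    have hn := (hmain z hz n).1
    have hn1 := (hmain z hz (n + 1)).1
    simp only [hU]
    rw [Finset.sum_range_succ, add_assoc n 1 q, add_comm 1 q]
    field_simp
    ring
  have hdiag : ∀ q, (∀ z : ℂ, max R (4 * ρ) < ‖z‖ → ∃ L, Tendsto (U q z) atTop (𝓝 L)) →
      ∃ L, Tendsto (fun n => T n (n + q)) atTop (𝓝 L) := by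
    intro q hq
    refine exists_tendsto_comp_add 1 (exists_tendsto_of_approx fun ε hε => ?_)
    -- At z = x the error is at most (2/x) · 2ρ^(q+2), the bound from `hlow` times that from
    -- `hmain`; this x makes it at most ε.
    set x : ℝ := max (max R (4 * ρ)) (4 * ρ ^ (q + 2) / ε) + 1 with hx
    have hx1 : max R (4 * ρ) < x := (le_max_left _ _).trans_lt (lt_add_one _)
    have hx2 : 4 * ρ ^ (q + 2) / ε ≤ x := (le_max_right _ _).trans (lt_add_one _).le
    have hx3 : 4 * ρ ≤ x := ((le_max_right _ _).trans_lt hx1).le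
    have hx0 : 0 < x := by linarith
    have hnorm : ‖(x : ℂ)‖ = x := by rw [Complex.norm_real, Real.norm_of_nonneg hx0.le]
    obtain ⟨L, hL⟩ := hq x (by rwa [hnorm])
    refine ⟨fun n => U q x (n + 1), ⟨L, hL.comp (tendsto_add_atTop_nat 1)⟩, fun n => ?_⟩
    beta_reduce
    rw [hstep x (by rwa [hnorm]), sub_add_cancel_left, norm_neg, norm_mul]
    calc _ ≤ 2 / x * (2 * ρ ^ (q + 1 + 1)) := by
          gcongr
          · simpa only [hnorm] using hlow x (by rwa [hnorm]) n
          · exact (hmain x (by rwa [hnorm]) n).2 (q + 1)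
      _ = 4 * ρ ^ (q + 2) / x := by ring
      _ ≤ ε := by
          rw [div_le_iff₀ hε] at hx2
          rw [div_le_iff₀ hx0]
          linarith
  have hUconv : ∀ q, ∀ z : ℂ, max R (4 * ρ) < ‖z‖ → ∃ L, Tendsto (U q z) atTop (𝓝 L) := by
    have hratio' : ∀ z : ℂ, max R (4 * ρ) < ‖z‖ →
        ∃ L, Tendsto (fun n => u z (n + 1) / u z n) atTop (𝓝 L) ∧
          ∀ n, u z (n + 1) / u z n = z - U 0 z n := by
      intro z hz
      have hz' : 4 * ρ ≤ ‖z‖ := ((le_max_right _ _).trans_lt hz).le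
      have hzpos : 0 < ‖z‖ := by linarith
      have heq : ∀ n, u z (n + 1) / u z n = z - U 0 z n := by
        intro n
        have hn := (hmain z hz' n).1
        simp only [hU, add_zero]
        rw [eq_sub_iff_add_eq, ← add_div, ← hrec, mul_div_cancel_right₀ _ hn]
      obtain ⟨L, hL⟩ := hratio z ((le_max_left _ _).trans_lt hz)
      -- The ratios stay away from 0, since u z (n+1) / u z n = z - U 0 z n is bounded by |z| + 2ρ.
      have hL0 : L ≠ 0 := by
        have hge : ∀ n, (‖z‖ + 2 * ρ)⁻¹ ≤ ‖u z n / u z (n + 1)‖ := by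
          intro n
          rw [← inv_div, norm_inv]
          refine inv_anti₀ (norm_pos_iff.2 (div_ne_zero (hmain z hz' _).1 (hmain z hz' _).1)) ?_
          rw [heq]
          refine (norm_sub_le _ _).trans ?_
          gcongr
          simpa using (hmain z hz' n).2 0
        have := ge_of_tendsto' hL.norm hge
        exact norm_pos_iff.1 (lt_of_lt_of_le (by positivity) this)
      refine ⟨L⁻¹, ?_, heq⟩
      simpa only [inv_div] using hL.inv₀ hL0
    intro q
    induction q with
    | zero =>
      intro z hz
      obtain ⟨L, hL, heq⟩ := hratio' z hz
      refine ⟨z - L, (hL.const_sub z).congr fun n => ?_⟩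
      rw [heq, sub_sub_cancel]
    | succ q ih =>
      intro z hz
      have hz' : 4 * ρ ≤ ‖z‖ := ((le_max_right _ _).trans_lt hz).le
      obtain ⟨L, hL, -⟩ := hratio' z hz
      obtain ⟨A, hA⟩ := ih z hz
      -- Convergence of U q for all large z gives that of the q-th diagonal; then `hstep`, solved
      -- for U (q+1), gives the next U.
      obtain ⟨B, hB⟩ := hdiag q ih
      refine ⟨_, (hL.mul ((hA.comp (tendsto_add_atTop_nat 1)).sub
        (hB.comp (tendsto_add_atTop_nat 1)))).congr fun n => ?_⟩
      have hn := (hmain z hz' n).1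
      have hn1 := (hmain z hz' (n + 1)).1
      simp only [Function.comp]
      rw [hstep z hz', add_sub_cancel_left]
      field_simp
  exact hdiag q (hUconv q)

/-- Convergence along diagonals passes to the powers of a column-finite Hessenberg matrix. -/
theorem exists_tendsto_pow_diagonal {c : ℕ → ℕ → ℕ → ℂ}
    (hT : ∀ r s, ∃ L, Tendsto (fun n => T (n + r) (n + s)) atTop (𝓝 L))
    (hc0 : ∀ k l, c 0 k l = if k = l then 1 else 0)
    (hsupp : ∀ j k l, l + j < k → c j k l = 0)
    (hc : ∀ j k l, c (j + 1) k l = ∑ m ∈ Finset.range (l + 2), c j k m * T m l) (j : ℕ) :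
    ∀ r s, ∃ L, Tendsto (fun n => c j (n + r) (n + s)) atTop (𝓝 L) := by
  induction j with
  | zero =>
    intro r s
    refine ⟨if r = s then 1 else 0, tendsto_const_nhds.congr fun n => ?_⟩
    simp [hc0]
  | succ j ih =>
    intro r s
    -- After replacing n by n + j, all terms with m < n vanish by `hsupp`, so m = n + t with t in a
    -- range independent of n.
    refine exists_tendsto_comp_add j ?_
    choose A hA using ih
    choose B hB using hT
    refine ⟨_, (tendsto_finsetSum (Finset.range (j + s + 2)) fun t _ =>
      (hA (j + r) t).mul (hB t (j + s))).congr fun n => ?_⟩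
    symm
    rw [hc, show n + j + s + 2 = n + (j + s + 2) by lia, Finset.sum_range_add _ n,
      Finset.sum_eq_zero, zero_add]
    · simp only [add_assoc]
    · intro m hm
      rw [hsupp j _ m (by have := Finset.mem_range.1 hm; lia), zero_mul]

end Recurrence

/-! ### Power sums of the zeros as traces of truncated matrices. -/

section Trace

/-- Split p into linear factors: each det(A - a) is a value of the characteristic polynomial up to
sign. Taking p = t - X^j below yields the eigenvalues of A^j with multiplicity. -/
theorem det_aeval_eq_prod_roots_charpoly {n K : Type*} [Fintype n] [DecidableEq n] [Field K]
    [IsAlgClosed K] (A : Matrix n n K) (p : K[X]) :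
    (aeval A p).det = (A.charpoly.roots.map fun r => p.eval r).prod := by
  have hsplit : A.charpoly.Splits := IsAlgClosed.splits A.charpoly
  have hcard : A.charpoly.roots.card = Fintype.card n := by
    rw [← hsplit.natDegree_eq_card_roots, A.charpoly_natDegree_eq_dim]
  have hlin (a : K) : (aeval A (X - C a)).det = (A.charpoly.roots.map fun r => r - a).prod := by
    have h1 : aeval A (X - C a) = -(Matrix.scalar n a - A) := by
      rw [map_sub, aeval_X, aeval_C, neg_sub]
      rfl
    rw [h1, Matrix.det_neg, ← Matrix.eval_charpoly, hsplit.eval_eq_prod_roots_of_monic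
      A.charpoly_monic, ← hcard, ← Multiset.card_map (fun r => a - r) A.charpoly.roots,
      ← Multiset.prod_map_neg, Multiset.map_map]
    simp
  have hprod (s : Multiset K) : (aeval A (s.map fun a => X - C a).prod).det =
      (A.charpoly.roots.map fun r => eval r (s.map fun a => X - C a).prod).prod := by
    induction s using Multiset.induction_on with
    | empty => simp
    | cons a s ih =>
      rw [Multiset.map_cons, Multiset.prod_cons, map_mul, Matrix.det_mul, ih, hlin,
        ← Multiset.prod_map_mul]
      simp
  conv_lhs => rw [(IsAlgClosed.splits p).eq_prod_roots]
  rw [map_mul, aeval_C, Matrix.det_mul, hprod, Matrix.algebraMap_eq_diagonal, Matrix.det_diagonal]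
  conv_rhs => rw [(IsAlgClosed.splits p).eq_prod_roots]
  simp only [eval_mul, eval_C, Multiset.prod_map_mul]
  simp [hcard]

theorem trace_pow_eq_sum_roots_charpoly {n K : Type*} [Fintype n] [DecidableEq n] [Field K]
    [IsAlgClosed K] (A : Matrix n n K) (j : ℕ) :
    (A ^ j).trace = (A.charpoly.roots.map fun r => r ^ j).sum := by
  have h : (A ^ j).charpoly = ((A.charpoly.roots.map fun r => r ^ j).map fun a => X - C a).prod := by
    refine Polynomial.funext fun t => ?_
    have h1 : Matrix.scalar n t - A ^ j = aeval A (C t - X ^ j) := by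
      rw [map_sub, map_pow, aeval_X, aeval_C]
      rfl
    rw [Matrix.eval_charpoly, h1, det_aeval_eq_prod_roots_charpoly, eval_multiset_prod]
    simp [Multiset.map_map]
  rw [Matrix.trace_eq_sum_roots_charpoly, h, roots_multiset_prod_X_sub_C]

variable {μ : Measure ℂ}

/-- The `n × n` truncation of the matrix of multiplication by `X`. -/
noncomputable def truncHess (μ : Measure ℂ) (n : ℕ) : Matrix (Fin n) (Fin n) ℂ :=
  Matrix.of fun i j => hess μ i j

/-- The recurrence read modulo Φ_n: (Φ_0, …, Φ_{n-1}) is a left eigenvector of the truncation up to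
the term that leaves it. -/
theorem vecMul_charmatrix_truncHess [IsFiniteMeasure μ] (hc : IsCompact μ.support)
    (hinf : μ.support.Infinite) (n : ℕ) (l : Fin n) :
    Matrix.vecMul (fun k : Fin n => monicPoly μ k) (truncHess μ n).charmatrix l =
      monicPoly μ n * C (hess μ n l) := by
  have hX : X * monicPoly μ l = ∑ k ∈ Finset.range (n + 1), C (hess μ k l) * monicPoly μ k := by
    rw [X_mul_monicPoly hc hinf]
    refine Finset.sum_subset (Finset.range_mono (by have := l.2; lia)) fun k _ hk => ?_
    rw [hess_eq_zero hc hinf (not_lt.1 (Finset.mem_range.not.1 hk)), C_0, zero_mul]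
  simp only [Matrix.vecMul, dotProduct, Matrix.charmatrix_apply, mul_sub, Finset.sum_sub_distrib]
  rw [Finset.sum_eq_single l (fun k _ hk => by rw [Matrix.diagonal_apply_ne _ hk, mul_zero])
    (by simp), Matrix.diagonal_apply_eq, mul_comm, hX, Finset.sum_range_succ]
  simp only [truncHess, Matrix.of_apply]
  rw [Fin.sum_univ_eq_sum_range (fun k => monicPoly μ k * C (hess μ k l)) n]
  simp only [mul_comm (monicPoly μ _)]
  ring

theorem charpoly_truncHess [IsFiniteMeasure μ] (hc : IsCompact μ.support)
    (hinf : μ.support.Infinite) (n : ℕ) : (truncHess μ n).charpoly = monicPoly μ n := by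
  rcases Nat.eq_zero_or_pos n with rfl | hn
  · rw [Matrix.charpoly_isEmpty, monicPoly_zero]
  · refine eq_of_monic_of_dvd_of_natDegree_le (monicPoly_monic μ n)
      (truncHess μ n).charpoly_monic ?_ ?_
    · set v : Fin n → ℂ[X] := fun k => monicPoly μ k with hv
      set M := (truncHess μ n).charmatrix with hM
      -- Since M · adj M = det M, entry 0 is det M · Φ_0 = det M, while every entry of v M is a
      -- multiple of Φ_n. Hence Φ_n divides the characteristic polynomial, and both are monic of
      -- degree n.
      have h1 : Matrix.vecMul (Matrix.vecMul v M) M.adjugate ⟨0, hn⟩ =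
          (truncHess μ n).charpoly := by
        rw [Matrix.vecMul_vecMul, Matrix.mul_adjugate, Matrix.vecMul_smul, Matrix.vecMul_one,
          Pi.smul_apply, show v ⟨0, hn⟩ = 1 from monicPoly_zero μ, smul_eq_mul, mul_one]
        rfl
      rw [← h1, Matrix.vecMul, dotProduct]
      refine Finset.dvd_sum fun l _ => Dvd.dvd.mul_right ?_ _
      rw [hM, hv, vecMul_charmatrix_truncHess hc hinf]
      exact dvd_mul_right _ _
    · rw [Matrix.charpoly_natDegree_eq_dim, Fintype.card_fin, monicPoly_natDegree]

/-- Multiplication by z raises the degree by one, so j steps starting from Φ_l with l + j < n never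
meet the truncation. -/
theorem truncHess_pow_apply [IsFiniteMeasure μ] (hc : IsCompact μ.support)
    (hinf : μ.support.Infinite) {n : ℕ} (j : ℕ) (k l : Fin n) (h : l + j < n) :
    (truncHess μ n ^ j) k l = fourierCoeff μ k (X ^ j * monicPoly μ l) := by
  induction j generalizing l with
  | zero =>
    rw [pow_zero, pow_zero, one_mul, fourierCoeff_monicPoly hc hinf, Matrix.one_apply]
    simp [Fin.ext_iff]
  | succ j ih =>
    rw [pow_succ, Matrix.mul_apply, fourierCoeff_X_pow_succ hc hinf]
    have h1 : ∀ m : Fin n, (truncHess μ n ^ j) k m * truncHess μ n m l =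
        fourierCoeff μ k (X ^ j * monicPoly μ m) * hess μ m l := by
      intro m
      rcases le_or_gt (m : ℕ) (l + 1) with hm | hm
      · rw [ih m (by lia)]
        rfl
      · rw [truncHess, Matrix.of_apply, hess_eq_zero hc hinf hm, mul_zero, mul_zero]
    rw [Finset.sum_congr rfl fun m _ => h1 m, Fin.sum_univ_eq_sum_range
      (fun m => fourierCoeff μ k (X ^ j * monicPoly μ m) * hess μ m l) n]
    symm
    refine Finset.sum_subset (Finset.range_mono (by lia)) fun m _ hm => ?_
    rw [hess_eq_zero hc hinf (not_lt.1 (Finset.mem_range.not.1 hm)), mul_zero]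

/-- The bound ρ^(i+1) need not decay away from the diagonal. The weights (2ρ)^k turn the column sum
into a geometric one, bounded uniformly in n; they cancel on the diagonal entries of powers, which
are all that the trace needs. -/
theorem sum_weight_mul_norm_hess_le [IsFiniteMeasure μ] (hc : IsCompact μ.support)
    (hinf : μ.support.Infinite) {ρ : ℝ} (hρ : 0 ≤ ρ) (hs : μ.support ⊆ Metric.closedBall 0 ρ)
    (n l : ℕ) :
    ∑ k ∈ Finset.range n, (2 * ρ) ^ k * ‖hess μ k l‖ ≤ 4 * ρ * (2 * ρ) ^ l := by
  have hterm : ∀ k ∈ Finset.range (l + 2),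
      (2 * ρ) ^ k * ‖hess μ k l‖ ≤ 2 ^ k * ρ ^ (l + 1) := by
    intro k hk
    rw [mul_pow, mul_assoc]
    have hk' : k ≤ l + 1 := by have := Finset.mem_range.1 hk; lia
    gcongr
    rcases hk'.eq_or_lt with rfl | hlt
    · rw [hess_succ hc hinf, norm_one, mul_one]
    · obtain ⟨i, rfl⟩ := Nat.exists_eq_add_of_le (Nat.lt_succ_iff.1 hlt)
      calc _ ≤ ρ ^ k * ρ ^ (i + 1) := by gcongr; exact norm_hess_le hc hinf hρ hs k i
        _ = _ := by rw [← pow_add, add_assoc]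
  calc _ ≤ ∑ k ∈ Finset.range (n + (l + 2)), (2 * ρ) ^ k * ‖hess μ k l‖ :=
        Finset.sum_le_sum_of_subset_of_nonneg (Finset.range_mono (by lia))
          fun _ _ _ => by positivity
    _ = ∑ k ∈ Finset.range (l + 2), (2 * ρ) ^ k * ‖hess μ k l‖ := by
        refine (Finset.sum_subset (Finset.range_mono (by lia)) fun k _ hk => ?_).symm
        rw [hess_eq_zero hc hinf (not_lt.1 (Finset.mem_range.not.1 hk)), norm_zero, mul_zero]
    _ ≤ ∑ k ∈ Finset.range (l + 2), 2 ^ k * ρ ^ (l + 1) := Finset.sum_le_sum hterm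
    _ = (2 ^ (l + 2) - 1) * ρ ^ (l + 1) := by
        rw [← Finset.sum_mul, geom_sum_eq (by norm_num)]
        norm_num
    _ ≤ 2 ^ (l + 2) * ρ ^ (l + 1) := by
        gcongr
        linarith
    _ = _ := by ring

theorem norm_truncHess_pow_apply_self_le [IsFiniteMeasure μ] (hc : IsCompact μ.support)
    (hinf : μ.support.Infinite) {ρ : ℝ} (hρ : 0 < ρ) (hs : μ.support ⊆ Metric.closedBall 0 ρ)
    {n : ℕ} (j : ℕ) (l : Fin n) : ‖(truncHess μ n ^ j) l l‖ ≤ (4 * ρ) ^ j := by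
  have hsum : ∀ l : Fin n, ∑ k : Fin n, (2 * ρ) ^ (k : ℕ) * ‖(truncHess μ n ^ j) k l‖ ≤
      (4 * ρ) ^ j * (2 * ρ) ^ (l : ℕ) := by
    induction j with
    | zero =>
      intro l
      rw [Finset.sum_eq_single l (fun k _ hk => by simp [Matrix.one_apply_ne hk]) (by simp)]
      simp
    | succ j ih =>
      intro l
      calc _ ≤ ∑ k : Fin n, (2 * ρ) ^ (k : ℕ) *
            ∑ m : Fin n, ‖(truncHess μ n ^ j) k m‖ * ‖truncHess μ n m l‖ := by
            gcongr with k
            rw [pow_succ, Matrix.mul_apply]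
            exact (norm_sum_le _ _).trans_eq (by simp only [norm_mul])
        _ = ∑ m : Fin n, (∑ k : Fin n, (2 * ρ) ^ (k : ℕ) * ‖(truncHess μ n ^ j) k m‖) *
            ‖truncHess μ n m l‖ := by
            simp only [Finset.mul_sum, Finset.sum_mul]
            rw [Finset.sum_comm]
            simp only [mul_assoc]
        _ ≤ ∑ m : Fin n, (4 * ρ) ^ j * (2 * ρ) ^ (m : ℕ) * ‖truncHess μ n m l‖ := by
            gcongr with m
            exact ih m
        _ = (4 * ρ) ^ j * ∑ m ∈ Finset.range n, (2 * ρ) ^ m * ‖hess μ m l‖ := by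
            simp only [mul_assoc, Finset.mul_sum]
            rw [← Fin.sum_univ_eq_sum_range]
            rfl
        _ ≤ (4 * ρ) ^ j * (4 * ρ * (2 * ρ) ^ (l : ℕ)) := by
            gcongr
            exact sum_weight_mul_norm_hess_le hc hinf hρ.le hs n l
        _ = _ := by ring
  have h1 := (Finset.single_le_sum (f := fun k : Fin n => (2 * ρ) ^ (k : ℕ) *
    ‖(truncHess μ n ^ j) k l‖) (fun k _ => by positivity) (Finset.mem_univ l)).trans (hsum l)
  have h2 : 0 < (2 * ρ) ^ (l : ℕ) := by positivity
  rw [mul_comm ((4 * ρ) ^ j)] at h1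
  exact le_of_mul_le_mul_left h1 h2

theorem integral_sum_dirac (g : ℂ → ℂ) (s : Multiset ℂ) :
    Integrable g (s.map fun z => Measure.dirac z).sum ∧
      ∫ z, g z ∂(s.map fun z => Measure.dirac z).sum = (s.map g).sum := by
  induction s using Multiset.induction_on with
  | empty => simp
  | cons a s ih =>
    have ha : Integrable g (Measure.dirac a) := integrable_dirac (by simp)
    simp only [Multiset.map_cons, Multiset.sum_cons]
    refine ⟨ha.add_measure ih.1, ?_⟩
    rw [integral_add_measure ha ih.1, ih.2, integral_dirac]

theorem integral_zeroCounting [IsFiniteMeasure μ] (hc : IsCompact μ.support)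
    (hinf : μ.support.Infinite) (j n : ℕ) :
    ∫ z, z ^ j ∂(zeroCounting μ n) = (n⁻¹ : ℝ) • (truncHess μ n ^ j).trace := by
  have hlead : (leadCoeff μ n : ℂ) ≠ 0 := by
    have : leadCoeff μ n = (polyNorm μ (monicPoly μ n))⁻¹ := rfl
    rw [this]
    exact_mod_cast (inv_pos.2 (polyNorm_monicPoly_pos hc hinf n)).ne'
  -- For n = 0 the weight is ∞, whose `toReal` is 0, in agreement with the real convention 0⁻¹ = 0.
  rw [zeroCounting, integral_smul_measure, (integral_sum_dirac _ _).2, ENNReal.toReal_inv,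
    ENNReal.toReal_natCast, orthonormalPoly, roots_C_mul _ hlead, trace_pow_eq_sum_roots_charpoly,
    charpoly_truncHess hc hinf]

theorem norm_sum_le_of_eventually_zero {n j : ℕ} {D : ℝ} (hD : 0 ≤ D) (e : Fin n → ℂ)
    (hzero : ∀ k : Fin n, (k : ℕ) + j < n → e k = 0) (hbound : ∀ k, ‖e k‖ ≤ D) :
    ‖∑ k, e k‖ ≤ j * D := by
  calc _ ≤ ∑ k : Fin n, if n ≤ (k : ℕ) + j then D else 0 := by
        refine (norm_sum_le _ _).trans (Finset.sum_le_sum fun k _ => ?_)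
        split_ifs with h
        · exact hbound k
        · rw [hzero k (not_le.1 h), norm_zero]
    _ = ∑ k ∈ Finset.range n, if n ≤ k + j then D else 0 :=
        Fin.sum_univ_eq_sum_range (fun k => if n ≤ k + j then D else 0) n
    _ = ((Finset.range n).filter fun k => n ≤ k + j).card * D := by
        rw [← Finset.sum_filter, Finset.sum_const, nsmul_eq_mul]
    _ ≤ j * D := by
        gcongr
        have : ((Finset.range n).filter fun k => n ≤ k + j) ⊆ Finset.Ico (n - j) n := by
          intro k hk
          simp only [Finset.mem_filter, Finset.mem_range, Finset.mem_Ico] at hk ⊢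
          lia
        refine (Finset.card_le_card this).trans ?_
        rw [Nat.card_Ico]
        lia

theorem tendsto_trace_truncHess_pow [IsFiniteMeasure μ] (hc : IsCompact μ.support)
    (hinf : μ.support.Infinite) {j : ℕ} {L : ℂ}
    (hL : Tendsto (fun n => fourierCoeff μ n (X ^ j * monicPoly μ n)) atTop (𝓝 L)) :
    Tendsto (fun n : ℕ => (n⁻¹ : ℝ) • (truncHess μ n ^ j).trace) atTop (𝓝 L) := by
  obtain ⟨ρ, hρ, hs⟩ : ∃ ρ : ℝ, 0 < ρ ∧ μ.support ⊆ Metric.closedBall 0 ρ := by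
    obtain ⟨ρ, hρ⟩ := hc.isBounded.subset_closedBall 0
    exact ⟨max ρ 1, by positivity, hρ.trans (Metric.closedBall_subset_closedBall (le_max_left _ _))⟩
  obtain ⟨D, hD⟩ := (Metric.isBounded_range_of_tendsto _ hL).exists_norm_le
  have hD' : ∀ n, ‖fourierCoeff μ n (X ^ j * monicPoly μ n)‖ ≤ D :=
    fun n => hD _ (Set.mem_range_self n)
  have hD0 : 0 ≤ D := (norm_nonneg _).trans (hD' 0)
  -- At most j diagonal entries differ, each by at most (4ρ)^j + D.
  have hdiff : Tendsto (fun n : ℕ => (n⁻¹ : ℝ) • ((truncHess μ n ^ j).trace -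
      ∑ k ∈ Finset.range n, fourierCoeff μ k (X ^ j * monicPoly μ k))) atTop (𝓝 0) := by
    have hlim : Tendsto (fun n : ℕ => (n⁻¹ : ℝ) * (j * ((4 * ρ) ^ j + D))) atTop (𝓝 0) := by
      simpa using tendsto_inv_atTop_nhds_zero_nat.mul_const (j * ((4 * ρ) ^ j + D))
    refine squeeze_zero_norm (fun n => ?_) hlim
    rw [norm_smul, Real.norm_of_nonneg (by positivity), Matrix.trace, ← Fin.sum_univ_eq_sum_range
      (fun k => fourierCoeff μ k (X ^ j * monicPoly μ k)), ← Finset.sum_sub_distrib]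
    gcongr
    refine norm_sum_le_of_eventually_zero (by positivity) _ (fun k hk => ?_) fun k => ?_
    · rw [Matrix.diag_apply, truncHess_pow_apply hc hinf j k k hk, sub_self]
    · refine (norm_sub_le _ _).trans (add_le_add ?_ (hD' k))
      exact norm_truncHess_pow_apply_self_le hc hinf hρ hs j k
  have hsum := hdiff.add hL.cesaro_smul
  rw [zero_add] at hsum
  refine hsum.congr fun n => ?_
  rw [← smul_add, sub_add_cancel]

end Trace

/-! ### Application to the orthogonal polynomials. -/

section RatioAsymptotics

variable {μ : Measure ℂ}

theorem exists_tendsto_hess [IsFiniteMeasure μ] (hc : IsCompact μ.support)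
    (hinf : μ.support.Infinite) {R : ℝ}
    (hratio : ∀ z : ℂ, R < ‖z‖ → ∃ L, Tendsto
      (fun n => (monicPoly μ n).eval z / (monicPoly μ (n + 1)).eval z) atTop (𝓝 L)) (r s : ℕ) :
    ∃ L, Tendsto (fun n => hess μ (n + r) (n + s)) atTop (𝓝 L) := by
  obtain ⟨ρ, hρ, hs⟩ : ∃ ρ : ℝ, 0 < ρ ∧ μ.support ⊆ Metric.closedBall 0 ρ := by
    obtain ⟨ρ, hρ⟩ := hc.isBounded.subset_closedBall 0
    exact ⟨max ρ 1, by positivity, hρ.trans (Metric.closedBall_subset_closedBall (le_max_left _ _))⟩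
  -- On or above the diagonal the limit comes from the ratios; the subdiagonal is constantly 1, and
  -- below it the entries vanish.
  rcases lt_trichotomy r (s + 1) with h | rfl | h
  · obtain ⟨q, rfl⟩ := Nat.exists_eq_add_of_le (Nat.lt_succ_iff.1 h)
    obtain ⟨L, hL⟩ := exists_tendsto_diagonal hρ (norm_hess_le hc hinf hρ.le hs)
      (u := fun z n => (monicPoly μ n).eval z) (fun z => by rw [monicPoly_zero, eval_one])
      (fun z n => by
        have := congrArg (eval z) (X_mul_monicPoly hc hinf n)
        rw [Finset.sum_range_succ, hess_succ hc hinf] at this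
        simpa [eval_finsetSum, add_comm] using this) hratio q
    refine ⟨L, (hL.comp (tendsto_add_atTop_nat r)).congr fun n => ?_⟩
    simp only [Function.comp, add_assoc]
  · refine ⟨1, tendsto_const_nhds.congr fun n => ?_⟩
    rw [← add_assoc, hess_succ hc hinf]
  · refine ⟨0, tendsto_const_nhds.congr fun n => ?_⟩
    rw [hess_eq_zero hc hinf (by lia)]

theorem exists_tendsto_fourierCoeff [IsFiniteMeasure μ] (hc : IsCompact μ.support)
    (hinf : μ.support.Infinite) {R : ℝ}
    (hratio : ∀ z : ℂ, R < ‖z‖ → ∃ L, Tendsto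
      (fun n => (monicPoly μ n).eval z / (monicPoly μ (n + 1)).eval z) atTop (𝓝 L)) (j : ℕ) :
    ∃ L, Tendsto (fun n => fourierCoeff μ n (X ^ j * monicPoly μ n)) atTop (𝓝 L) :=
  exists_tendsto_pow_diagonal (c := fun j k l => fourierCoeff μ k (X ^ j * monicPoly μ l))
    (exists_tendsto_hess hc hinf hratio)
    (fun k l => by rw [pow_zero, one_mul, fourierCoeff_monicPoly hc hinf])
    (fun _ _ _ h => fourierCoeff_X_pow_mul_eq_zero hc hinf h)
    (fourierCoeff_X_pow_succ hc hinf) j 0 0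

end RatioAsymptotics

end OrthoPoly

theorem corollary1p11 (μ : Measure ℂ) [IsFiniteMeasure μ]
    (hcompact : IsCompact μ.support) (hinfinite : μ.support.Infinite)
    (R : ℝ) (hR : 0 < R) (f : OnePoint ℂ → ℂ) (hf : OrthoPoly.AnalyticOnExterior f R)
    (hratio : ∀ z ∈ OrthoPoly.exterior R,
      Tendsto (fun n : ℕ =>
        OrthoPoly.ratioAt (OrthoPoly.monicPoly μ n) (OrthoPoly.monicPoly μ (n + 1)) z)
        atTop (𝓝 (f z))) :
    ∀ j : ℕ, ∃ L : ℂ,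
      Tendsto (fun n : ℕ => ∫ z, z ^ j ∂(OrthoPoly.zeroCounting μ n)) atTop (𝓝 L) ∧
      Tendsto (fun n : ℕ =>
        ∫ z, z ^ j * ((‖(OrthoPoly.orthonormalPoly μ n).eval z‖ ^ 2 : ℝ) : ℂ) ∂μ)
        atTop (𝓝 L) := by
  intro j
  obtain ⟨L, hL⟩ := OrthoPoly.exists_tendsto_fourierCoeff hcompact hinfinite
    (fun z hz => ⟨_, hratio z (Or.inr ⟨z, hz, rfl⟩)⟩) j
  refine ⟨L, ?_, ?_⟩
  · simp only [OrthoPoly.integral_zeroCounting hcompact hinfinite]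
    exact OrthoPoly.tendsto_trace_truncHess_pow hcompact hinfinite hL
  · simp only [OrthoPoly.integral_mul_norm_orthonormalPoly_sq hcompact hinfinite]
    exact hL
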